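/- Let $A$ be a nonzero unital (complex) $C^*$-algebra that has at most one tracial state, and suppose that the tracial state of $A$, if it exists, is not a character (that is, not a nonzero $*$-homomorphism $A\to\mathbb{C}$). Let $U(A)$ be the unitary group of $A$ with the norm topology, let $U_A$ be the connected component of the unit in $U(A)$, let $CU_A=\overline{(U_A,U_A)}$ be the closure of the commutator subgroup of $U_A$, and let $\mathcal{Z}(CU_A)$ be the center of $CU_A$. Then $A$ is simple (its only closed two-sided ideals are $\{0\}$ and $A$) if and only if both of the following hold: the quotient topological group $CU_A/\mathcal{Z}(CU_A)$ is topologically simple, i.e. its only closed normal subgroups are the trivial subgroup and the whole group; and $\mathcal{Z}(CU_A)\subseteq\mathbb{T}$, where $\mathbb{T}=\{z1_A : z\in\mathbb{C},\ |z|=1\}$. -/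

import Mathlib

open scoped ComplexOrder

/-- A tracial state on a unital C*-algebra: a positive linear functional `τ` with `τ 1 = 1`
and `τ (a * b) = τ (b * a)`. (The positive elements of a C*-algebra are the `star a * a`.) -/
structure IsTracialState {A : Type*} [CStarAlgebra A] (τ : A →ₗ[ℂ] ℂ) : Prop where
  nonneg : ∀ a : A, 0 ≤ τ (star a * a)
  map_one : τ 1 = 1
  map_mul_comm : ∀ a b : A, τ (a * b) = τ (b * a)

/-- A linear functional is a character if it is a nonzero `*`-homomorphism to `ℂ`. -/
def IsCharacter {A : Type*} [CStarAlgebra A] (τ : A →ₗ[ℂ] ℂ) : Prop :=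
  ∃ χ : A →⋆ₙₐ[ℂ] ℂ, χ ≠ 0 ∧ ∀ a : A, χ a = τ a

/-- Simplicity of a C*-algebra: it is nonzero, and its only closed two-sided ideals are
zero and the whole algebra. -/
def IsSimpleCStar (A : Type*) [CStarAlgebra A] : Prop :=
  Nontrivial A ∧ ∀ I : TwoSidedIdeal A, IsClosed (I : Set A) → I = ⊥ ∨ I = ⊤

/-- `U_A`, the connected component of the unit in the unitary group `U(A)` (norm topology). -/
def unitaryComponent (A : Type*) [CStarAlgebra A] : Subgroup (unitary A) :=
  Subgroup.connectedComponentOfOne (unitary A)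

/-- `CU_A`, the closure of the commutator subgroup of `U_A`. -/
def closedCommutatorUnitary (A : Type*) [CStarAlgebra A] : Subgroup (unitary A) :=
  (⁅unitaryComponent A, unitaryComponent A⁆ : Subgroup (unitary A)).topologicalClosure

/-- A topological group is topologically simple if its only closed normal subgroups are the
trivial subgroup and the whole group. -/
def IsTopologicallySimple (G : Type*) [Group G] [TopologicalSpace G] : Prop :=
  ∀ N : Subgroup G, N.Normal → IsClosed (N : Set G) → N = ⊥ ∨ N = ⊤

/-!
The proof passes from closed groups of unitaries to their tangent spaces. For a closed subgroup `N`
of the unitary group, the self-adjoint `a` with `exp (i t a) ∈ N` for all real `t` form a closed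
real subspace (`tangentSpace`), and a curve in `N` through `1` with velocity `i a` shows that `a`
is tangent to `N`, since `γ (1 / n) ^ n → exp (i a)` (`tendsto_pow_expUnitary`). All `i [a, b]` are
tangent to `CU_A`, and conversely a closed group of unitaries to which all `i [a, b]` are tangent
contains `CU_A` (`closedCommutatorUnitary_le_of_lieI_mem`).

Suppose that `A` is simple. An element of the center of `CU_A` commutes with all commutators, hence
with `A`, and so is a scalar. Let `N` be a closed normal subgroup of `CU_A` with a noncentral
element `u`. Differentiating `(u, exp (i t k)) ∈ N` shows that `u k u* - k` is tangent to `N` for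
each `k` tangent to `CU_A`, so the tangent space of `N` is not central; and its complex span `V`
satisfies `[V, [A, A]] ⊆ V`. A `*`-version of Herstein's theorem on Lie ideals,
`lie_mem_of_lie_lie_mem`, gives `[A, A] ⊆ V`, whence `N = CU_A`.

Conversely, let `J` be a closed ideal other than `0` and `A`, and let `N` be the closed normal
subgroup of those elements of `CU_A` that are scalar modulo `J`. If `N = CU_A`, all commutators are
scalar modulo `J`, which forces them into `J`. If `N` is contained in the center, and so consists
of scalars, then `[a, b] = 0` for self-adjoint `a ∈ J` and all `b`; then `J` contains a nonzero
central element, whose annihilator contains all commutators. Either way some proper ideal contains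
all commutators, so `A` has a character by the Gelfand–Mazur theorem. A character is a tracial
state, which contradicts the hypothesis on tracial states.
-/

/-! ### Commutators in simple algebras -/

section Algebra

attribute [local instance] LieRing.ofAssociativeRing

variable {A : Type*} [CStarAlgebra A]

/-- For self-adjoint `x`, nilpotency of `D = [x, ·]` forces `D = 0`. As `D (a*) = -(D a)*`, the
Leibniz rule turns `D ^ (k + 1) = 0` into
`0 = D ^ (2 k) (a a*) = ± (2k choose k) D ^ k a (D ^ k a)*`, whence `D ^ k = 0`. -/
lemma lie_eq_zero_of_iterate_four {x : A} (hx : IsSelfAdjoint x)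
    (h : ∀ a : A, ⁅x, ⁅x, ⁅x, ⁅x, a⁆⁆⁆⁆ = 0) (a : A) : ⁅x, a⁆ = 0 := by
  obtain ⟨D, hD⟩ : ∃ D : A →+ A, ∀ a, D a = ⁅x, a⁆ :=
    ⟨AddMonoidHom.mk' (fun a => ⁅x, a⁆) (fun a b => lie_add x a b), fun _ => rfl⟩
  have leib (a b : A) : D (a * b) = D a * b + a * D b := by
    simp only [hD, Ring.lie_def]; noncomm_ring
  have hs (a : A) : D (star a) = -star (D a) := by
    simp only [hD, Ring.lie_def, star_sub, star_mul, hx.star_eq]; noncomm_ring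
  have key (n : ℕ) (hn : n ≠ 0) (b : A) (hb : n • (b * star b) = 0) : b = 0 := by
    have : (n : ℂ) • (b * star b) = 0 := by rw [Nat.cast_smul_eq_nsmul]; exact hb
    rcases smul_eq_zero.mp this with h | h
    · exact absurd (by exact_mod_cast h) hn
    · exact CStarRing.mul_star_self_eq_zero_iff b |>.mp h
  have h4 (a : A) : D (D (D (D a))) = 0 := by simp only [hD]; exact h a
  have h3 (a : A) : D (D (D a)) = 0 := by
    apply key 20 (by norm_num)
    have e : D (D (D (D (D (D (a * star a)))))) = 0 := by rw [h4]
    simp only [leib, map_add, h4, hs, map_neg, mul_zero, zero_mul, add_zero, zero_add, neg_zero,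
      neg_neg, star_zero, mul_neg] at e
    rw [← neg_eq_zero, ← e]
    abel
  have h2 (a : A) : D (D a) = 0 := by
    apply key 6 (by norm_num)
    have e : D (D (D (D (a * star a)))) = 0 := by rw [h3]
    simp only [leib, map_add, h3, hs, map_neg, mul_zero, zero_mul, add_zero, zero_add, neg_zero,
      neg_neg, star_zero, mul_neg] at e
    rw [← e]
    abel
  rw [← hD]
  apply key 2 (by norm_num)
  have e : D (D (a * star a)) = 0 := h2 _
  simp only [leib, map_add, h2, hs, map_neg, mul_zero, zero_mul, add_zero, zero_add, neg_zero,
      star_zero, mul_neg] at e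
  rw [← neg_eq_zero, ← e]
  abel

lemma eq_zero_of_forall_mul_mul_eq_zero {x : A} (h : ∀ b : A, x * b * x = 0) : x = 0 := by
  have h1 : (x * star x) * star (x * star x) = 0 := by
    have := h (star x)
    simp only [star_mul, star_star, ← mul_assoc, this, zero_mul]
  exact CStarRing.mul_star_self_eq_zero_iff x |>.mp
    (CStarRing.mul_star_self_eq_zero_iff _ |>.mp h1)

/-- The centralizer of the commutators is the center. Expanding `[u, [a, b a]] = 0` gives
`[a, b] [u, a] = 0`, and replacing `b` by `u b` gives `[u, a] b [u, a] = 0`. -/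
lemma commute_of_commute_lie {u : A} (h : ∀ a b : A, ⁅u, ⁅a, b⁆⁆ = 0) (a : A) : ⁅u, a⁆ = 0 := by
  have h1 (a b : A) : ⁅a, b⁆ * ⁅u, a⁆ = 0 := by
    have e : ⁅a, b⁆ * ⁅u, a⁆ = ⁅u, ⁅a, b * a⁆⁆ - ⁅u, ⁅a, b⁆⁆ * a := by
      simp only [Ring.lie_def]; noncomm_ring
    rw [e, h, h, zero_mul, sub_zero]
  apply eq_zero_of_forall_mul_mul_eq_zero
  intro b
  have e : ⁅u, a⁆ * b * ⁅u, a⁆ = u * (⁅a, b⁆ * ⁅u, a⁆) - ⁅a, u * b⁆ * ⁅u, a⁆ := by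
    simp only [Ring.lie_def]; noncomm_ring
  rw [e, h1, h1, mul_zero, sub_zero]

lemma lie_eq_zero_of_forall_isSelfAdjoint {x : A}
    (h : ∀ a : A, IsSelfAdjoint a → ⁅x, a⁆ = 0) (a : A) : ⁅x, a⁆ = 0 := by
  rw [← realPart_add_I_smul_imaginaryPart a, lie_add, lie_smul, h _ (realPart a).2,
    h _ (imaginaryPart a).2, smul_zero, add_zero]

lemma isSelfAdjoint_I_smul_lie {a b : A} (ha : IsSelfAdjoint a) (hb : IsSelfAdjoint b) :
    IsSelfAdjoint (Complex.I • ⁅a, b⁆) := by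
  simp only [IsSelfAdjoint, star_smul, Ring.lie_def, star_sub, star_mul, ha.star_eq, hb.star_eq]
  rw [← neg_sub (a * b), smul_neg]
  simp

/-- A C*-algebra whose commutators commute with each other is commutative. -/
lemma lie_eq_zero_of_lie_lie_lie_eq_zero (h : ∀ a b c d : A, ⁅⁅a, b⁆, ⁅c, d⁆⁆ = 0) (a b : A) :
    ⁅a, b⁆ = 0 := by
  have h1 (a b : A) (ha : IsSelfAdjoint a) (hb : IsSelfAdjoint b) (c : A) : ⁅⁅a, b⁆, c⁆ = 0 := by
    have := lie_eq_zero_of_iterate_four (isSelfAdjoint_I_smul_lie ha hb) (fun c => by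
      simp only [smul_lie, lie_smul]
      rw [h a b]
      simp) c
    simpa using this
  rw [← lie_skew, neg_eq_zero]
  refine lie_eq_zero_of_forall_isSelfAdjoint (fun a ha => ?_) a
  rw [← lie_skew, neg_eq_zero]
  refine lie_eq_zero_of_iterate_four ha (fun c => ?_) b
  have h2 (b : A) (hb : IsSelfAdjoint b) : ⁅⁅a, b⁆, a⁆ = 0 := h1 a b ha hb a
  have h3 (c : A) : ⁅a, ⁅a, c⁆⁆ = 0 := by
    rw [← realPart_add_I_smul_imaginaryPart c, lie_add, lie_smul, lie_add, lie_smul,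
      ← lie_skew, h2 _ (realPart c).2, ← lie_skew, h2 _ (imaginaryPart c).2]
    simp
  rw [h3]

variable (hsimple : ∀ J : AddSubgroup A, (∀ a, ∀ x ∈ J, a * x ∈ J) → (∀ a, ∀ x ∈ J, x * a ∈ J) →
  ∀ x ∈ J, x ≠ 0 → 1 ∈ J)

include hsimple in
/-- In a simple noncommutative C*-algebra the commutators generate everything as a ring. -/
lemma mem_subring_of_lie_mem (S : Subring A) (hS : ∀ a b : A, ⁅a, b⁆ ∈ S) (p q : A)
    (hpq : ⁅p, q⁆ ≠ 0) (s : A) : s ∈ S := by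
  obtain ⟨a, b, c, d, h0⟩ : ∃ a b c d : A, ⁅⁅a, b⁆, ⁅c, d⁆⁆ ≠ 0 := by
    by_contra! hcon
    exact hpq (lie_eq_zero_of_lie_lie_lie_eq_zero hcon p q)
  set x := ⁅a, b⁆
  set y := ⁅c, d⁆ with hy
  have h1 (a : A) : ⁅x, y⁆ * a ∈ S := by
    have e : ⁅x, y⁆ * a = ⁅x, y * a⁆ - y * ⁅x, a⁆ := by
      simp only [Ring.lie_def]; noncomm_ring
    rw [e]
    exact S.sub_mem (hS _ _) (S.mul_mem (hS _ _) (hS _ _))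
  have h2 (b a : A) : b * ⁅x, y⁆ * a ∈ S := by
    have e : b * ⁅x, y⁆ * a = ⁅b, ⁅x, y⁆ * a⁆ + ⁅x, y⁆ * (a * b) := by
      simp only [Ring.lie_def]; noncomm_ring
    rw [e]
    exact S.add_mem (hS _ _) (h1 _)
  let J : AddSubgroup A :=
    { carrier := {s | ∀ a b, a * s * b ∈ S}
      zero_mem' := by intro a b; simp [S.zero_mem]
      add_mem' := by
        intro s t hs ht a b
        rw [mul_add, add_mul]
        exact S.add_mem (hs a b) (ht a b)
      neg_mem' := by
        intro s hs a b
        rw [mul_neg, neg_mul]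
        exact S.neg_mem (hs a b) }
  have := hsimple J (fun c x hx a b => by simpa [mul_assoc] using hx (a * c) b)
    (fun c x hx a b => by simpa [mul_assoc] using hx a (c * b)) ⁅x, y⁆ h2 h0
  simpa using this s 1

include hsimple in
/-- Herstein's theorem in the `*`-invariant case: in a simple unital C*-algebra,
a noncentral `*`-invariant subspace `V` with `[V, [A, A]] ⊆ V` contains all commutators. -/
theorem lie_mem_of_lie_lie_mem (V : Submodule ℂ A) (hV : ∀ v ∈ V, ∀ a b : A, ⁅v, ⁅a, b⁆⁆ ∈ V)
    (hstar : ∀ v ∈ V, star v ∈ V) (v₀ p : A) (hv₀ : v₀ ∈ V) (hp : ⁅v₀, p⁆ ≠ 0) (a b : A) :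
    ⁅a, b⁆ ∈ V := by
  -- `T` is a subring, and it suffices to show `T = A`.
  let T : Submodule ℂ A :=
    { carrier := {x | ∀ a : A, ⁅x, a⁆ ∈ V}
      zero_mem' := by intro a; simp
      add_mem' := by intro x y hx hy a; rw [add_lie]; exact V.add_mem (hx a) (hy a)
      smul_mem' := by intro c x hx a; rw [smul_lie]; exact V.smul_mem c (hx a) }
  have mulT {x y : A} (hx : x ∈ T) (hy : y ∈ T) : x * y ∈ T := fun a => by
    have e : ⁅x * y, a⁆ = ⁅x, y * a⁆ + ⁅y, a * x⁆ := by
      simp only [Ring.lie_def]; noncomm_ring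
    rw [e]
    exact V.add_mem (hx _) (hy _)
  have starT {x : A} (hx : x ∈ T) : star x ∈ T := fun a => by
    have e : ⁅star x, a⁆ = -star ⁅x, star a⁆ := by
      simp only [Ring.lie_def, star_sub, star_mul, star_star]; noncomm_ring
    rw [e]
    exact V.neg_mem (hstar _ (hx _))
  have lieTV {x v : A} (hx : x ∈ T) (hv : v ∈ V) : ⁅x, v⁆ ∈ T := fun a => by
    rw [lie_lie]
    exact V.sub_mem (hx _) (hV v hv x a)
  have lieVV {v w : A} (hv : v ∈ V) (hw : w ∈ V) : ⁅v, w⁆ ∈ T := fun a => by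
    rw [lie_lie]
    exact V.sub_mem (hV v hv w a) (hV w hw v a)
  have lieTL {x : A} (hx : x ∈ T) (b c : A) : ⁅x, ⁅b, c⁆⁆ ∈ T := fun a => by
    have e : ⁅⁅x, ⁅b, c⁆⁆, a⁆ = ⁅x, ⁅⁅b, c⁆, a⁆⁆ + ⁅⁅x, a⁆, ⁅b, c⁆⁆ := by
      rw [lie_lie, ← lie_skew ⁅x, a⁆, sub_eq_add_neg]
    rw [e]
    exact V.add_mem (hx _) (hV _ (hx a) b c)
  -- Expand `[x, [y, a z]]` and antisymmetrize in `x` and `y`.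
  have leftT {x y z : A} (hx : x ∈ T) (hy : y ∈ T) (hz : z ∈ T) (a : A) :
      a * ⁅⁅x, y⁆, z⁆ ∈ T := by
    have e : a * ⁅⁅x, y⁆, z⁆ = (⁅x, ⁅y, a * z⁆⁆ - ⁅x, ⁅y, a⁆⁆ * z) -
        (⁅y, ⁅x, a * z⁆⁆ - ⁅y, ⁅x, a⁆⁆ * z) := by
      simp only [Ring.lie_def]; noncomm_ring
    rw [e]
    exact T.sub_mem (T.sub_mem (lieTV hx (hy _)) (mulT (lieTV hx (hy _)) hz))
      (T.sub_mem (lieTV hy (hx _)) (mulT (lieTV hy (hx _)) hz))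
  -- The largest left ideal inside `T`. The ring `S` of its right multipliers contains all
  -- commutators, so it is `A` and `R` is two-sided.
  let R : AddSubgroup A :=
    { carrier := {t | ∀ a, a * t ∈ T}
      zero_mem' := by intro a; simp [T.zero_mem]
      add_mem' := by intro s t hs ht a; rw [mul_add]; exact T.add_mem (hs a) (ht a)
      neg_mem' := by intro s hs a; rw [mul_neg]; exact T.neg_mem (hs a) }
  let S : Subring A :=
    { carrier := {s | ∀ t ∈ R, t * s ∈ R}
      zero_mem' := by intro t _; simp [R.zero_mem]
      one_mem' := by intro t ht; simpa using ht
      add_mem' := by intro s s' hs hs' t ht; rw [mul_add]; exact R.add_mem (hs t ht) (hs' t ht)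
      neg_mem' := by intro s hs t ht; rw [mul_neg]; exact R.neg_mem (hs t ht)
      mul_mem' := by intro s s' hs hs' t ht; rw [← mul_assoc]; exact hs' _ (hs t ht) }
  have hS (b c : A) : ⁅b, c⁆ ∈ S := fun t ht a => by
    have e : a * (t * ⁅b, c⁆) = ⁅a * t, ⁅b, c⁆⁆ + (⁅b, c⁆ * a) * t := by
      simp only [Ring.lie_def]; noncomm_ring
    rw [e]
    exact T.add_mem (lieTL (ht a) b c) (ht _)
  by_contra hab
  have hR (t : A) (ht : t ∈ R) : t = 0 := by
    by_contra h0
    have h1 : (1 : A) ∈ R := hsimple R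
      (fun a x hx b => by rw [← mul_assoc]; exact hx _)
      (fun a x hx => mem_subring_of_lie_mem hsimple S hS v₀ p hp a x hx) t ht h0
    exact hab (by simpa using h1 a b)
  have hTTT {x y z : A} (hx : x ∈ T) (hy : y ∈ T) (hz : z ∈ T) : ⁅⁅x, y⁆, z⁆ = 0 :=
    hR _ (leftT hx hy hz)
  have reim (W : Submodule ℂ A) (hW : ∀ v ∈ W, star v ∈ W) (x : A) (hx : x ∈ W) :
      (realPart x : A) ∈ W ∧ (imaginaryPart x : A) ∈ W := by
    rw [realPart_apply_coe, imaginaryPart_apply_coe]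
    refine ⟨?_, W.smul_mem _ ?_⟩
    · rw [← Complex.coe_smul]; exact W.smul_mem _ (W.add_mem hx (hW x hx))
    · rw [← Complex.coe_smul]; exact W.smul_mem _ (W.sub_mem hx (hW x hx))
  have central (W : Submodule ℂ A) (hW : ∀ v ∈ W, star v ∈ W)
      (h : ∀ x ∈ W, ∀ a : A, ⁅x, ⁅x, ⁅x, ⁅x, a⁆⁆⁆⁆ = 0) (x : A) (hx : x ∈ W) (a : A) : ⁅x, a⁆ = 0 := by
    rw [← realPart_add_I_smul_imaginaryPart x, add_lie, smul_lie,
      lie_eq_zero_of_iterate_four (realPart x).2 (h _ (reim W hW x hx).1),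
      lie_eq_zero_of_iterate_four (imaginaryPart x).2 (h _ (reim W hW x hx).2)]
    simp
  -- Since `R = 0`, first `T` and then `V` consist of elements `x` with `[x, ·]` nilpotent.
  have hT (x : A) (hx : x ∈ T) (a : A) : ⁅x, a⁆ = 0 := by
    refine central T (fun _ => starT) (fun x hx a => ?_) x hx a
    rw [← lie_skew, hTTT hx (lieTV hx (hx a)) hx, neg_zero]
  refine hp (central V hstar (fun v hv a => ?_) v₀ hv₀ p)
  rw [← lie_skew, hT _ (lieVV hv (hV v hv v a)), neg_zero]

include hsimple in
lemma exists_eq_algebraMap_of_central [Nontrivial A] (u : A) (hu : ∀ a : A, ⁅u, a⁆ = 0) :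
    ∃ z : ℂ, u = algebraMap ℂ A z := by
  obtain ⟨z, hz⟩ := spectrum.nonempty  u
  refine ⟨z, ?_⟩
  by_contra hne
  have hc (a : A) : (algebraMap ℂ A z - u) * a = a * (algebraMap ℂ A z - u) := by
    have := hu a
    rw [Ring.lie_def, sub_eq_zero] at this
    rw [sub_mul, mul_sub, this, Algebra.commutes]
  have h1 := hsimple (AddMonoidHom.mulLeft (algebraMap ℂ A z - u)).range
    (by
      rintro a _ ⟨y, rfl⟩
      exact ⟨a * y, by simp only [AddMonoidHom.coe_mulLeft, ← mul_assoc, hc a]⟩)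
    (by
      rintro a _ ⟨y, rfl⟩
      exact ⟨y * a, by simp only [AddMonoidHom.coe_mulLeft, mul_assoc]⟩)
    (algebraMap ℂ A z - u) ⟨1, by simp⟩ (sub_ne_zero.mpr (Ne.symm hne))
  obtain ⟨y, hy⟩ := h1
  rw [AddMonoidHom.coe_mulLeft] at hy
  exact hz (isUnit_iff_exists.mpr ⟨y, hy, by rw [← hc, hy]⟩)

end Algebra

/-! ### Tangent spaces of closed groups of unitaries -/

section Tangent

open selfAdjoint Filter Topology Complex

variable {A : Type*} [CStarAlgebra A]

lemma norm_unitary_pow_sub_pow_le (u v : unitary A) (n : ℕ) :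
    ‖((u ^ n : unitary A) : A) - ((v ^ n : unitary A) : A)‖ ≤ n * ‖(u : A) - v‖ := by
  induction n with
  | zero => simp
  | succ n ih =>
    have e : ((u ^ (n + 1) : unitary A) : A) - ((v ^ (n + 1) : unitary A) : A) =
        ((u ^ n : unitary A) : A) * ((u : A) - v) +
          (((u ^ n : unitary A) : A) - ((v ^ n : unitary A) : A)) * v := by
      rw [pow_succ, pow_succ, Submonoid.coe_mul, Submonoid.coe_mul]
      noncomm_ring
    rw [e]
    refine (norm_add_le _ _).trans ?_
    rw [CStarRing.norm_coe_unitary_mul, CStarRing.norm_mul_coe_unitary, Nat.cast_succ]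
    linarith

lemma expUnitary_smul_mul (a : selfAdjoint A) (s t : ℝ) :
    expUnitary ((s + t) • a) = expUnitary (s • a) * expUnitary (t • a) := by
  rw [add_smul]
  apply Commute.expUnitary_add
  simp only [selfAdjoint.val_smul]
  exact ((Commute.refl (a : A)).smul_left s).smul_right t

lemma expUnitary_neg (a : selfAdjoint A) : expUnitary (-a) = (expUnitary a)⁻¹ := by
  have h := expUnitary_smul_mul a (-1) 1
  rw [eq_inv_iff_mul_eq_one]
  simpa using h.symm

lemma expUnitary_nsmul (a : selfAdjoint A) (n : ℕ) :
    expUnitary ((n : ℝ) • a) = expUnitary a ^ n := by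
  induction n with
  | zero => simp
  | succ n ih => rw [Nat.cast_succ, expUnitary_smul_mul, ih, pow_succ, one_smul]

lemma hasDerivAt_expUnitary_smul (a : selfAdjoint A) :
    HasDerivAt (fun t : ℝ => (expUnitary (t • a) : A)) (I • (a : A)) 0 := by
  have h := hasDerivAt_exp_smul_const (𝕂 := ℝ) (I • (a : A)) (0 : ℝ)
  simp only [zero_smul, NormedSpace.exp_zero, one_mul] at h
  refine h.congr_of_eventuallyEq (Eventually.of_forall fun t => ?_)
  simp only [expUnitary_coe, selfAdjoint.val_smul]
  rw [smul_comm]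

/-- The Lie product formula for curves: a curve of unitaries through `1` with velocity `i a`
satisfies `γ (1 / n) ^ n → exp (i a)`. -/
lemma tendsto_pow_expUnitary (γ : ℝ → unitary A) (h1 : γ 0 = 1) (a : selfAdjoint A)
    (hγ : HasDerivAt (fun t => (γ t : A)) (I • (a : A)) 0) :
    Tendsto (fun n : ℕ => γ ((n : ℝ) + 1)⁻¹ ^ (n + 1)) atTop (𝓝 (expUnitary a)) := by
  rw [tendsto_subtype_rng, tendsto_iff_norm_sub_tendsto_zero]
  have hd := hγ.sub (hasDerivAt_expUnitary_smul a)
  rw [sub_self, hasDerivAt_iff_tendsto_slope_zero] at hd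
  have hs : Tendsto (fun n : ℕ => ((n : ℝ) + 1)⁻¹) atTop (𝓝[≠] 0) := by
    refine tendsto_nhdsWithin_iff.mpr ⟨?_, Eventually.of_forall fun n => ?_⟩
    · simpa using tendsto_one_div_add_atTop_nhds_zero_nat (𝕜 := ℝ)
    · exact inv_ne_zero (by positivity)
  have ht := (hd.comp hs).norm
  rw [norm_zero] at ht
  refine squeeze_zero (fun _ => norm_nonneg _) (fun n => ?_) ht
  have e : expUnitary a = expUnitary (((n : ℝ) + 1)⁻¹ • a) ^ (n + 1) := by
    rw [← expUnitary_nsmul, smul_smul, Nat.cast_succ, mul_inv_cancel₀ (by positivity), one_smul]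
  rw [e]
  refine (norm_unitary_pow_sub_pow_le _ _ _).trans (le_of_eq ?_)
  have hp : (0 : ℝ) ≤ (n : ℝ) + 1 := by positivity
  simp [norm_smul, h1, abs_of_nonneg hp]

lemma expUnitary_mem_of_hasDerivAt {N : Subgroup (unitary A)} (hN : IsClosed (N : Set (unitary A)))
    (γ : ℝ → unitary A) (hmem : ∀ t, γ t ∈ N) (h1 : γ 0 = 1) (a : selfAdjoint A)
    (hγ : HasDerivAt (fun t => (γ t : A)) (I • (a : A)) 0) (t : ℝ) :
    expUnitary (t • a) ∈ N := by
  have hγ' : HasDerivAt (fun s => (γ (t * s) : A)) (I • ((t • a : selfAdjoint A) : A)) 0 := by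
    have h2 : HasDerivAt (fun s : ℝ => t * s) t 0 := by
      simpa using (hasDerivAt_id (0 : ℝ)).const_mul t
    have h3 : HasDerivAt (fun t => (γ t : A)) (I • (a : A)) (t * 0) := by rwa [mul_zero]
    have := h3.scomp (0 : ℝ) h2
    rwa [smul_comm, ← selfAdjoint.val_smul] at this
  exact hN.mem_of_tendsto (tendsto_pow_expUnitary (fun s => γ (t * s)) (by simpa using h1) _ hγ')
    (Eventually.of_forall fun n => N.pow_mem (hmem _) _)

lemma hasDerivAt_expUnitary_mul_expUnitary (a b : selfAdjoint A) :
    HasDerivAt (fun t : ℝ => ((expUnitary (t • a) * expUnitary (t • b) : unitary A) : A))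
      (I • ((a + b : selfAdjoint A) : A)) 0 := by
  refine ((hasDerivAt_expUnitary_smul a).fun_mul (hasDerivAt_expUnitary_smul b)).congr_deriv ?_
  simp

lemma expUnitary_add_mem {N : Subgroup (unitary A)} (hN : IsClosed (N : Set (unitary A)))
    {a b : selfAdjoint A} (h : ∀ t : ℝ, expUnitary (t • a) * expUnitary (t • b) ∈ N) (t : ℝ) :
    expUnitary (t • (a + b)) ∈ N := by
  refine expUnitary_mem_of_hasDerivAt hN (fun t => expUnitary (t • a) * expUnitary (t • b)) h
    (by simp) _ (hasDerivAt_expUnitary_mul_expUnitary a b) t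

/-- The tangent space at `1` of a closed group `N` of unitaries: the self-adjoint `a` for which
the one-parameter group `t ↦ exp (i t a)` lies in `N`. -/
def tangentSpace (N : Subgroup (unitary A)) (hN : IsClosed (N : Set (unitary A))) :
    Submodule ℝ (selfAdjoint A) where
  carrier := {a | ∀ t : ℝ, expUnitary (t • a) ∈ N}
  zero_mem' := by intro t; simp [N.one_mem]
  add_mem' := fun ha hb => expUnitary_add_mem hN fun t => N.mul_mem (ha t) (hb t)
  smul_mem' := by intro c a ha t; rw [smul_smul]; exact ha _

lemma mem_tangentSpace {N : Subgroup (unitary A)} {hN : IsClosed (N : Set (unitary A))}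
    {a : selfAdjoint A} : a ∈ tangentSpace N hN ↔ ∀ t : ℝ, expUnitary (t • a) ∈ N := Iff.rfl

lemma isClosed_tangentSpace (N : Subgroup (unitary A)) (hN : IsClosed (N : Set (unitary A))) :
    IsClosed (tangentSpace N hN : Set (selfAdjoint A)) := by
  have : (tangentSpace N hN : Set (selfAdjoint A)) =
      ⋂ t : ℝ, (fun a => expUnitary (t • a)) ⁻¹' (N : Set (unitary A)) := by
    ext a
    simp [mem_tangentSpace]
  rw [this]
  exact isClosed_iInter fun t => hN.preimage (continuous_expUnitary.comp (continuous_const_smul t))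

/-- Conjugation of a self-adjoint element by a unitary. -/
def unitaryConj (u : unitary A) (a : selfAdjoint A) : selfAdjoint A :=
  ⟨u * a * star (u : A), a.2.conjugate _⟩

lemma unitaryConj_smul (u : unitary A) (t : ℝ) (a : selfAdjoint A) :
    unitaryConj u (t • a) = t • unitaryConj u a := by
  ext
  simp [unitaryConj]

lemma expUnitary_unitaryConj (u : unitary A) (a : selfAdjoint A) :
    expUnitary (unitaryConj u a) = u * expUnitary a * u⁻¹ := by
  let +nondep : NormedAlgebra ℚ A := .restrictScalars ℚ ℂ A
  ext
  have h := NormedSpace.exp_units_conj (Unitary.toUnits u) (I • (a : A))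
  rw [mul_smul_comm, smul_mul_assoc] at h
  exact h

/-- The self-adjoint commutator `i [a, b]` of self-adjoint elements. -/
def lieI (a b : selfAdjoint A) : selfAdjoint A :=
  ⟨I • ⁅(a : A), (b : A)⁆, isSelfAdjoint_I_smul_lie a.2 b.2⟩

/-- Differentiating the conjugation action of a one-parameter group. -/
lemma lieI_mem_of_unitaryConj_sub_mem {W : Submodule ℝ (selfAdjoint A)}
    (hW : IsClosed (W : Set (selfAdjoint A))) {k h : selfAdjoint A}
    (hmem : ∀ s : ℝ, unitaryConj (expUnitary (s • k)) h - h ∈ W) : lieI k h ∈ W := by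
  have hd : HasDerivAt (fun s : ℝ => (unitaryConj (expUnitary (s • k)) h : A))
      (lieI k h : A) 0 := by
    have h1 := ((hasDerivAt_expUnitary_smul k).mul_const (h : A)).fun_mul
      (hasDerivAt_expUnitary_smul (-k))
    have e : (fun s : ℝ => (unitaryConj (expUnitary (s • k)) h : A)) =
        fun s : ℝ => (expUnitary (s • k) : A) * h * (expUnitary (s • (-k)) : A) := by
      funext s
      rw [smul_neg, expUnitary_neg]
      rfl
    rw [e]
    refine h1.congr_deriv ?_
    simp [lieI, Ring.lie_def, sub_eq_add_neg]
  rw [hasDerivAt_iff_tendsto_slope_zero] at hd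
  have ht : Tendsto (fun s : ℝ => s⁻¹ • (unitaryConj (expUnitary (s • k)) h - h)) (𝓝[≠] 0)
      (𝓝 (lieI k h)) := by
    rw [tendsto_subtype_rng]
    refine hd.congr fun s => ?_
    simp [unitaryConj]
  exact hW.mem_of_tendsto ht (Eventually.of_forall fun s => W.smul_mem _ (hmem s))

/-- The complex span `W + i W` of a real space `W` of self-adjoint elements, described through real
and imaginary parts. -/
def complexification (W : Submodule ℝ (selfAdjoint A)) : Submodule ℂ A where
  carrier := {x | realPart x ∈ W ∧ imaginaryPart x ∈ W}
  zero_mem' := by simp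
  add_mem' := by
    rintro x y ⟨hx, hx'⟩ ⟨hy, hy'⟩
    rw [Set.mem_ofPred_eq, map_add, map_add]
    exact ⟨W.add_mem hx hy, W.add_mem hx' hy'⟩
  smul_mem' := by
    rintro c x ⟨hx, hx'⟩
    rw [Set.mem_ofPred_eq, realPart_smul, imaginaryPart_smul]
    exact ⟨W.sub_mem (W.smul_mem _ hx) (W.smul_mem _ hx'),
      W.add_mem (W.smul_mem _ hx') (W.smul_mem _ hx)⟩

lemma mem_complexification {W : Submodule ℝ (selfAdjoint A)} {x : A} :
    x ∈ complexification W ↔ realPart x ∈ W ∧ imaginaryPart x ∈ W := Iff.rfl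

lemma coe_mem_complexification {W : Submodule ℝ (selfAdjoint A)} {a : selfAdjoint A} :
    (a : A) ∈ complexification W ↔ a ∈ W := by
  rw [mem_complexification, a.2.imaginaryPart]
  have : realPart (a : A) = a := Subtype.ext a.2.coe_realPart
  simp [this]

lemma star_mem_complexification {W : Submodule ℝ (selfAdjoint A)} {x : A}
    (hx : x ∈ complexification W) : star x ∈ complexification W := by
  obtain ⟨h1, h2⟩ := hx
  rw [← realPart_add_I_smul_imaginaryPart x, star_add, star_smul, (realPart x).2.star_eq,
    (imaginaryPart x).2.star_eq]
  exact Submodule.add_mem _ (coe_mem_complexification.mpr h1)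
    (Submodule.smul_mem _ _ (coe_mem_complexification.mpr h2))

attribute [local instance] LieRing.ofAssociativeRing

lemma lie_mem_complexification {W W₁ W₂ : Submodule ℝ (selfAdjoint A)}
    (h : ∀ a ∈ W₁, ∀ b ∈ W₂, lieI a b ∈ W) {x y : A} (hx : x ∈ complexification W₁)
    (hy : y ∈ complexification W₂) : ⁅x, y⁆ ∈ complexification W := by
  have h0 (a : selfAdjoint A) (ha : a ∈ W₁) (b : selfAdjoint A) (hb : b ∈ W₂) :
      ⁅(a : A), (b : A)⁆ ∈ complexification W := by
    have h1 := Submodule.smul_mem _ (-I) (coe_mem_complexification.mpr (h a ha b hb))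
    simpa [lieI, smul_smul] using h1
  rw [← realPart_add_I_smul_imaginaryPart x, ← realPart_add_I_smul_imaginaryPart y]
  simp only [lie_add, add_lie, lie_smul, smul_lie]
  have h11 := h0 _ hx.1 _ hy.1
  have h12 := h0 _ hx.1 _ hy.2
  have h21 := h0 _ hx.2 _ hy.1
  have h22 := h0 _ hx.2 _ hy.2
  exact Submodule.add_mem _
    (Submodule.add_mem _ h11 (Submodule.smul_mem _ _ h21))
    (Submodule.smul_mem _ _ (Submodule.add_mem _ h12 (Submodule.smul_mem _ _ h22)))

lemma lie_mem_complexification_of_forall {W : Submodule ℝ (selfAdjoint A)}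
    (h : ∀ a b : selfAdjoint A, lieI a b ∈ W) (x y : A) : ⁅x, y⁆ ∈ complexification W :=
  lie_mem_complexification (W₁ := ⊤) (W₂ := ⊤) (fun a _ b _ => h a b)
    ⟨Submodule.mem_top, Submodule.mem_top⟩ ⟨Submodule.mem_top, Submodule.mem_top⟩

/-- If `a - b` is tangent to the closed normal subgroup `M`, then `exp (i a)` and `exp (i b)` agree
modulo `M`. -/
lemma expUnitary_mul_inv_mem {M : Subgroup (unitary A)} [M.Normal]
    (hM : IsClosed (M : Set (unitary A))) {a b : selfAdjoint A} (hab : a - b ∈ tangentSpace M hM) :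
    expUnitary a * (expUnitary b)⁻¹ ∈ M := by
  have hd : HasDerivAt (fun t : ℝ =>
      ((expUnitary (t • (a - b)) * expUnitary (t • b) : unitary A) : A)) (I • (a : A)) 0 := by
    simpa only [sub_add_cancel] using hasDerivAt_expUnitary_mul_expUnitary (a - b) b
  have ht := (tendsto_pow_expUnitary _ (by simp) a hd).mul_const (expUnitary b)⁻¹
  refine hM.mem_of_tendsto ht (Eventually.of_forall fun n => ?_)
  set s := ((n : ℝ) + 1)⁻¹ with hs
  have e : expUnitary b = expUnitary (s • b) ^ (n + 1) := by
    rw [← expUnitary_nsmul, smul_smul, Nat.cast_succ, mul_inv_cancel₀ (by positivity), one_smul]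
  rw [e, SetLike.mem_coe, ← QuotientGroup.eq_one_iff]
  have h1 : ((expUnitary (s • (a - b)) : unitary A) : unitary A ⧸ M) = 1 :=
    (QuotientGroup.eq_one_iff _).mpr (hab s)
  simp only [QuotientGroup.mk_mul, QuotientGroup.mk_pow, QuotientGroup.mk_inv, h1, one_mul]
  exact mul_inv_cancel _

lemma expUnitary_mem_unitaryComponent (a : selfAdjoint A) :
    expUnitary a ∈ unitaryComponent A := by
  change expUnitary a ∈ connectedComponent (1 : unitary A)
  rw [← pathComponent_eq_connectedComponent]
  exact joined_one_expUnitary a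

lemma unitaryComponent_le {H : Subgroup (unitary A)} (h : ∀ a : selfAdjoint A, expUnitary a ∈ H) :
    unitaryComponent A ≤ H := by
  intro u hu
  change u ∈ connectedComponent (1 : unitary A) at hu
  rw [← pathComponent_eq_connectedComponent, Unitary.mem_pathComponentOne_iff] at hu
  obtain ⟨l, rfl⟩ := hu
  refine H.list_prod_mem fun x hx => ?_
  obtain ⟨a, -, rfl⟩ := List.mem_map.mp hx
  exact h a

lemma isClosed_closedCommutatorUnitary :
    IsClosed (closedCommutatorUnitary A : Set (unitary A)) :=
  Subgroup.isClosed_topologicalClosure _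

/-- Commutators are tangent to `CU_A`: `t ↦ (exp (i t b), v)` has velocity `i (b - v b v*)`, which is
then differentiated along `v = exp (i s a)`. -/
lemma lieI_mem_tangentSpace_closedCommutatorUnitary (a b : selfAdjoint A) :
    lieI a b ∈ tangentSpace (closedCommutatorUnitary A) isClosed_closedCommutatorUnitary := by
  refine lieI_mem_of_unitaryConj_sub_mem (isClosed_tangentSpace _ _) fun s => ?_
  rw [sub_eq_add_neg]
  refine expUnitary_add_mem isClosed_closedCommutatorUnitary fun t => ?_
  rw [← unitaryConj_smul, expUnitary_unitaryConj, smul_neg, expUnitary_neg]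
  exact Subgroup.le_topologicalClosure _ (Subgroup.commutator_mem_commutator
    (expUnitary_mem_unitaryComponent _) (expUnitary_mem_unitaryComponent _))

/-- A closed normal subgroup of the unitary group whose tangent space contains all
commutators contains `CU_A`. -/
lemma closedCommutatorUnitary_le {M : Subgroup (unitary A)} [M.Normal]
    (hM : IsClosed (M : Set (unitary A))) (h : ∀ a b : selfAdjoint A, lieI a b ∈ tangentSpace M hM) :
    closedCommutatorUnitary A ≤ M := by
  refine Subgroup.topologicalClosure_minimal _ (Subgroup.commutator_le.mpr fun u hu v _ => ?_) hM
  -- The unitaries commuting with `v` modulo `M` form a subgroup, so exponentials suffice.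
  have hC : unitaryComponent A ≤
      (Subgroup.centralizer {(v : unitary A ⧸ M)}).comap (QuotientGroup.mk' M) := by
    refine unitaryComponent_le fun a => ?_
    -- `a - v a v* = [a v*, v]` is a commutator.
    have hb : a - unitaryConj v a ∈ tangentSpace M hM := by
      rw [← coe_mem_complexification]
      have e : ((a - unitaryConj v a : selfAdjoint A) : A) = ⁅(a : A) * star (v : A), (v : A)⁆ := by
        simp [unitaryConj, Ring.lie_def, mul_assoc]
      rw [e]
      exact lie_mem_complexification_of_forall h _ _
    have := expUnitary_mul_inv_mem hM hb
    rw [expUnitary_unitaryConj, ← QuotientGroup.eq_one_iff, QuotientGroup.mk_mul,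
      QuotientGroup.mk_inv, mul_inv_eq_one, QuotientGroup.mk_mul, QuotientGroup.mk_mul,
      QuotientGroup.mk_inv, eq_mul_inv_iff_mul_eq] at this
    rw [Subgroup.mem_comap, Subgroup.mem_centralizer_singleton_iff]
    exact this
  have := hC hu
  rw [Subgroup.mem_comap, Subgroup.mem_centralizer_singleton_iff] at this
  rw [← QuotientGroup.eq_one_iff, commutatorElement_def, QuotientGroup.mk_mul, QuotientGroup.mk_inv,
    mul_inv_eq_one, QuotientGroup.mk_mul, QuotientGroup.mk_mul, QuotientGroup.mk_inv,
    mul_inv_eq_iff_eq_mul]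
  exact this

lemma isClosed_normalCore {N : Subgroup (unitary A)} (hN : IsClosed (N : Set (unitary A))) :
    IsClosed (N.normalCore : Set (unitary A)) := by
  have : (N.normalCore : Set (unitary A)) =
      ⋂ b : unitary A, (fun a => b * a * b⁻¹) ⁻¹' (N : Set (unitary A)) := by
    ext a
    simp only [Set.mem_iInter]
    rfl
  rw [this]
  exact isClosed_iInter fun b => hN.preimage (by fun_prop)

/-- `CU_A` is generated by the exponentials of commutators. Normality of `N` is not needed: the
normal core of `N` has the same tangent commutators, because conjugation by a unitary permutes
the commutators. -/
lemma closedCommutatorUnitary_le_of_lieI_mem {N : Subgroup (unitary A)}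
    (hN : IsClosed (N : Set (unitary A))) (h : ∀ a b : selfAdjoint A, lieI a b ∈ tangentSpace N hN) :
    closedCommutatorUnitary A ≤ N := by
  refine (closedCommutatorUnitary_le (isClosed_normalCore hN) fun a b t u => ?_).trans
    N.normalCore_le
  have e : unitaryConj u (lieI a b) = lieI (unitaryConj u a) (unitaryConj u b) := by
    ext
    have hu (x : A) : star (u : A) * ((u : A) * x) = x := by rw [← mul_assoc]; simp
    simp [unitaryConj, lieI, Ring.lie_def, mul_sub, sub_mul, mul_assoc, hu]
  rw [← expUnitary_unitaryConj, unitaryConj_smul, e]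
  exact h _ _ t

end Tangent

/-! ### From a simple algebra to a topologically simple group -/

section Simple

open selfAdjoint Filter Topology Complex

attribute [local instance] LieRing.ofAssociativeRing

variable {A : Type*} [CStarAlgebra A]

/-- Invertible elements being open, a dense ideal contains `1`; so topological simplicity of a unital
C*-algebra implies algebraic simplicity. -/
lemma IsSimpleCStar.one_mem (hA : IsSimpleCStar A) (J : AddSubgroup A)
    (hl : ∀ a, ∀ x ∈ J, a * x ∈ J) (hr : ∀ a, ∀ x ∈ J, x * a ∈ J) (x : A) (hx : x ∈ J)
    (hx0 : x ≠ 0) : 1 ∈ J := by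
  let I : TwoSidedIdeal A := .mk' (J.topologicalClosure : Set A)
    (zero_mem _) (fun h h' => add_mem h h') (fun h => neg_mem h)
    (fun {a y} h => map_mem_closure (continuous_const_mul a) h fun z hz => hl a z hz)
    (fun {y a} h => map_mem_closure (f := fun z => z * a) (continuous_mul_const a) h
      fun z hz => hr a z hz)
  have memI (y : A) : y ∈ I ↔ y ∈ closure (J : Set A) := TwoSidedIdeal.mem_mk' ..
  have hI : IsClosed (I : Set A) := by
    have : (I : Set A) = closure (J : Set A) := Set.ext memI
    rw [this]
    exact isClosed_closure
  rcases hA.2 I hI with h | h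
  · refine absurd ?_ hx0
    have : x ∈ I := (memI x).mpr (subset_closure hx)
    rwa [h, TwoSidedIdeal.mem_bot] at this
  · have h1 : (1 : A) ∈ closure (J : Set A) := (memI 1).mp (by rw [h]; trivial)
    obtain ⟨y, ⟨u, rfl⟩, hy⟩ := mem_closure_iff.mp h1 {y | IsUnit y} Units.isOpen isUnit_one
    simpa using hl (↑u⁻¹ : A) u hy

lemma unitaryConj_eq_of_forall_expUnitary {u : unitary A} {k : selfAdjoint A}
    (h : ∀ t : ℝ, u * expUnitary (t • k) * u⁻¹ = expUnitary (t • k)) : unitaryConj u k = k := by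
  have h1 := hasDerivAt_expUnitary_smul (unitaryConj u k)
  simp only [← unitaryConj_smul, expUnitary_unitaryConj, h] at h1
  have h2 := h1.unique (hasDerivAt_expUnitary_smul k)
  exact Subtype.ext (smul_right_injective A I_ne_zero h2)

lemma lie_eq_zero_iff_unitaryConj_eq {u : unitary A} {k : selfAdjoint A} :
    ⁅(u : A), (k : A)⁆ = 0 ↔ unitaryConj u k = k := by
  rw [Subtype.ext_iff, Ring.lie_def, sub_eq_zero]
  constructor
  · intro h
    simp [unitaryConj, h, mul_assoc]
  · intro h
    conv_rhs => rw [← h]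
    simp [unitaryConj, mul_assoc]

lemma lie_eq_zero_of_unitaryConj_lieI_eq {u : unitary A}
    (h : ∀ a b : selfAdjoint A, unitaryConj u (lieI a b) = lieI a b) (x : A) : ⁅(u : A), x⁆ = 0 := by
  refine commute_of_commute_lie (fun a b => ?_) x
  let W : Submodule ℝ (selfAdjoint A) :=
    { carrier := {k | ⁅(u : A), (k : A)⁆ = 0}
      zero_mem' := by simp
      add_mem' := by
        intro k l (hk : _ = _) (hl : _ = _)
        change ⁅(u : A), (k : A) + l⁆ = 0
        rw [lie_add, hk, hl, add_zero]
      smul_mem' := by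
        intro c k (hk : _ = _)
        change ⁅(u : A), c • (k : A)⁆ = 0
        rw [lie_smul, hk, smul_zero] }
  have hW : ⁅a, b⁆ ∈ complexification W :=
    lie_mem_complexification_of_forall (fun a b => lie_eq_zero_iff_unitaryConj_eq.mpr (h a b)) a b
  obtain ⟨h1, h2⟩ := mem_complexification.mp hW
  change ⁅(u : A), _⁆ = 0 at h1 h2
  rw [← realPart_add_I_smul_imaginaryPart ⁅a, b⁆, lie_add, lie_smul, h1, h2, smul_zero, add_zero]

/-- If `u a u* - a` commutes with `u`, it vanishes: otherwise `uⁿ a u*ⁿ` would grow linearly. -/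
lemma unitaryConj_eq_self {u : unitary A} {a : selfAdjoint A}
    (h : unitaryConj u (unitaryConj u a - a) = unitaryConj u a - a) : unitaryConj u a = a := by
  set z := unitaryConj u a - a with hz
  have hpow (n : ℕ) : unitaryConj (u ^ n) a = a + (n : ℝ) • z := by
    induction n with
    | zero => ext; simp [unitaryConj]
    | succ n ih =>
      have e : unitaryConj (u ^ (n + 1)) a = unitaryConj u (unitaryConj (u ^ n) a) := by
        ext; simp [unitaryConj, pow_succ', mul_assoc]
      have e2 (b c : selfAdjoint A) : unitaryConj u (b + c) = unitaryConj u b + unitaryConj u c := by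
        ext; simp [unitaryConj, mul_add, add_mul]
      have e3 : unitaryConj u a = a + z := by rw [hz]; abel
      rw [e, ih, e2, unitaryConj_smul, h, e3, Nat.cast_succ, add_smul, one_smul]
      abel
  have hnorm (n : ℕ) : (n : ℝ) * ‖z‖ ≤ 2 * ‖a‖ := by
    have h1 : (n : ℝ) • z = unitaryConj (u ^ n) a - a := by rw [hpow]; abel
    have h2 : ‖unitaryConj (u ^ n) a‖ = ‖a‖ := by
      change ‖((u ^ n : unitary A) : A) * a * ((star (u ^ n) : unitary A) : A)‖ = _
      rw [CStarRing.norm_mul_coe_unitary, CStarRing.norm_coe_unitary_mul]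
      rfl
    calc (n : ℝ) * ‖z‖ = ‖(n : ℝ) • z‖ := by rw [norm_smul]; simp
      _ ≤ ‖unitaryConj (u ^ n) a‖ + ‖a‖ := by rw [h1]; exact norm_sub_le _ _
      _ = 2 * ‖a‖ := by rw [h2]; ring
  have hz0 : z = 0 := by
    by_contra hne
    have hpos : 0 < ‖z‖ := norm_pos_iff.mpr hne
    obtain ⟨n, hn⟩ := exists_nat_gt (2 * ‖a‖ / ‖z‖)
    rw [div_lt_iff₀ hpos] at hn
    exact absurd (hnorm n) (not_le.mpr hn)
  exact sub_eq_zero.mp hz0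

/-- A closed subgroup of the unitaries normalized by `CU_A` and containing a noncentral element of
`CU_A` contains `CU_A`, if `A` is simple. -/
theorem IsSimpleCStar.closedCommutatorUnitary_le (hA : IsSimpleCStar A) {N : Subgroup (unitary A)}
    (hN : IsClosed (N : Set (unitary A)))
    (hnorm : ∀ c ∈ closedCommutatorUnitary A, ∀ n ∈ N, c * n * c⁻¹ ∈ N) {u : unitary A} (hu : u ∈ N)
    {x : A} (hx : ⁅(u : A), x⁆ ≠ 0) : closedCommutatorUnitary A ≤ N := by
  have hlie (h : selfAdjoint A) (hh : h ∈ tangentSpace N hN) (k : selfAdjoint A)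
      (hk : k ∈ tangentSpace (closedCommutatorUnitary A) isClosed_closedCommutatorUnitary) :
      lieI h k ∈ tangentSpace N hN := by
    have h1 : lieI k h ∈ tangentSpace N hN := by
      refine lieI_mem_of_unitaryConj_sub_mem (isClosed_tangentSpace N hN) fun s => ?_
      refine Submodule.sub_mem _ (fun t => ?_) hh
      rw [← unitaryConj_smul, expUnitary_unitaryConj]
      exact hnorm _ (hk s) _ (hh t)
    have e : lieI h k = -lieI k h := by
      ext
      simp [lieI, Ring.lie_def, ← smul_neg]
    rw [e]
    exact Submodule.neg_mem _ h1
  have hconj (k : selfAdjoint A)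
      (hk : k ∈ tangentSpace (closedCommutatorUnitary A) isClosed_closedCommutatorUnitary) :
      unitaryConj u k - k ∈ tangentSpace N hN := by
    rw [sub_eq_add_neg]
    refine expUnitary_add_mem hN fun t => ?_
    rw [← unitaryConj_smul, expUnitary_unitaryConj, smul_neg, expUnitary_neg, mul_assoc, mul_assoc]
    refine N.mul_mem hu ?_
    rw [← mul_assoc]
    exact hnorm _ (hk t) _ (N.inv_mem hu)
  obtain ⟨v, hv, p, hp⟩ : ∃ v ∈ complexification (tangentSpace N hN), ∃ p : A, ⁅v, p⁆ ≠ 0 := by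
    by_contra! hcon
    -- If the tangent space were central, `u k u* - k` would commute with `u` for all `k` tangent to
    -- `CU_A`, hence vanish, and `u` would commute with all commutators.
    refine hx (lie_eq_zero_of_unitaryConj_lieI_eq (fun a b => unitaryConj_eq_self ?_) x)
    rw [← lie_eq_zero_iff_unitaryConj_eq, ← lie_skew, neg_eq_zero]
    exact hcon _ (coe_mem_complexification.mpr
      (hconj _ (lieI_mem_tangentSpace_closedCommutatorUnitary a b))) _
  refine closedCommutatorUnitary_le_of_lieI_mem hN fun a b => ?_
  rw [← coe_mem_complexification]
  -- `lieI a b` is `i` times a commutator, so the complex span suffices.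
  refine Submodule.smul_mem _ _ (lie_mem_of_lie_lie_mem hA.one_mem _ (fun w hw a b => ?_)
    (fun w hw => star_mem_complexification hw) v p hv hp _ _)
  exact lie_mem_complexification hlie hw
    (lie_mem_complexification_of_forall lieI_mem_tangentSpace_closedCommutatorUnitary a b)

theorem IsSimpleCStar.exists_eq_algebraMap_of_mem_center (hA : IsSimpleCStar A)
    (u : closedCommutatorUnitary A) (hu : u ∈ Subgroup.center (closedCommutatorUnitary A)) :
    ∃ z : ℂ, ‖z‖ = 1 ∧ ((u : unitary A) : A) = algebraMap ℂ A z := by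
  have := hA.1
  have hc (x : A) : ⁅((u : unitary A) : A), x⁆ = 0 := by
    refine lie_eq_zero_of_unitaryConj_lieI_eq (fun a b => ?_) x
    refine unitaryConj_eq_of_forall_expUnitary fun t => ?_
    rw [mul_inv_eq_iff_eq_mul]
    exact (congrArg Subtype.val (Subgroup.mem_center_iff.mp hu
      ⟨_, lieI_mem_tangentSpace_closedCommutatorUnitary a b t⟩)).symm
  obtain ⟨z, hz⟩ := exists_eq_algebraMap_of_central hA.one_mem _ hc
  refine ⟨z, ?_, hz⟩
  have h1 := CStarRing.norm_coe_unitary (u : unitary A)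
  rwa [hz, norm_algebraMap'] at h1

theorem IsSimpleCStar.isTopologicallySimple (hA : IsSimpleCStar A) :
    IsTopologicallySimple
      (closedCommutatorUnitary A ⧸ Subgroup.center (closedCommutatorUnitary A)) := by
  intro N' hN' hclosed
  by_cases hbot : N' = ⊥
  · exact Or.inl hbot
  right
  obtain ⟨q, hq, hq1⟩ := N'.bot_or_exists_ne_one.resolve_left hbot
  obtain ⟨u, rfl⟩ := QuotientGroup.mk_surjective q
  let K : Subgroup (closedCommutatorUnitary A) := N'.comap (QuotientGroup.mk' _)
  have hKn : K.Normal := hN'.comap _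
  have hK : IsClosed (K : Set (closedCommutatorUnitary A)) :=
    hclosed.preimage QuotientGroup.continuous_mk
  have hN : IsClosed ((K.map (closedCommutatorUnitary A).subtype : Subgroup (unitary A)) :
      Set (unitary A)) :=
    isClosed_closedCommutatorUnitary.isClosedEmbedding_subtypeVal.isClosedMap _ hK
  obtain ⟨x, hx⟩ : ∃ x : A, ⁅((u : unitary A) : A), x⁆ ≠ 0 := by
    by_contra! hcon
    refine hq1 ((QuotientGroup.eq_one_iff _).mpr (Subgroup.mem_center_iff.mpr fun g => ?_))
    have := hcon ((g : unitary A) : A)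
    rw [Ring.lie_def, sub_eq_zero] at this
    exact Subtype.ext (Subtype.ext this.symm)
  have hle := hA.closedCommutatorUnitary_le hN (by
    rintro c hc _ ⟨n, hn, rfl⟩
    exact ⟨⟨c, hc⟩ * n * ⟨c, hc⟩⁻¹,
      hKn.conj_mem n hn ⟨c, hc⟩, rfl⟩) ⟨u, hq, rfl⟩ hx
  rw [eq_top_iff]
  intro q _
  obtain ⟨g, rfl⟩ := QuotientGroup.mk_surjective q
  obtain ⟨n, hn, hng⟩ := hle g.2
  rw [← show n = g from Subtype.ext hng]
  exact hn

/-! ### Characters -/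

/-- A proper left ideal containing all commutators is contained in the kernel of a character: it
extends to a maximal left ideal `M`, which is two-sided and closed, and `A ⧸ M` is a Banach
field, hence `ℂ` by Gelfand–Mazur. -/
lemma exists_algHom_complex (J : Ideal A) (hJ : J ≠ ⊤) (hlie : ∀ a b : A, ⁅a, b⁆ ∈ J) :
    Nonempty (A →ₐ[ℂ] ℂ) := by
  obtain ⟨M, hM, hJM⟩ := Ideal.exists_le_maximal J hJ
  have hMlie (a b : A) : ⁅a, b⁆ ∈ M := hJM (hlie a b)
  have : M.IsTwoSided := ⟨fun {a} b ha => by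
    have e : a * b = b * a + ⁅a, b⁆ := by rw [Ring.lie_def]; abel
    rw [e]
    exact M.add_mem (M.mul_mem_left b ha) (hMlie a b)⟩
  have hMc : IsClosed (M : Set A) := Ideal.IsMaximal.isClosed
  let _ : NormedRing (A ⧸ M) :=
    { Submodule.Quotient.normedAddCommGroup M, Ideal.Quotient.ring M with
      norm_mul_le := by
        intro x y
        refine le_of_forall_gt_imp_ge_of_dense fun c hc => ?_
        have ht : Tendsto (fun ε : ℝ => (‖x‖ + ε) * (‖y‖ + ε)) (𝓝[>] 0) (𝓝 (‖x‖ * ‖y‖)) := by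
          have : Continuous fun ε : ℝ => (‖x‖ + ε) * (‖y‖ + ε) := by fun_prop
          simpa using (this.tendsto 0).mono_left nhdsWithin_le_nhds
        obtain ⟨ε, hε, hε0⟩ := ((ht.eventually_lt_const hc).and self_mem_nhdsWithin).exists
        obtain ⟨a, rfl, ha⟩ := Submodule.Quotient.norm_mk_lt x hε0
        obtain ⟨b, rfl, hb⟩ := Submodule.Quotient.norm_mk_lt y hε0
        calc _ ≤ ‖a * b‖ := Submodule.Quotient.norm_mk_le M (a * b)
          _ ≤ ‖a‖ * ‖b‖ := norm_mul_le a b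
          _ ≤ _ := (mul_le_mul ha.le hb.le (norm_nonneg _) ((norm_nonneg _).trans ha.le)).trans hε.le }
  let _ : NormedAlgebra ℂ (A ⧸ M) :=
    { Submodule.Quotient.normedSpace M ℂ,
      (Ideal.Quotient.algebra ℂ : Algebra ℂ (A ⧸ M)) with }
  have hcomm (a b : A) : Ideal.Quotient.mk M (a * b) = Ideal.Quotient.mk M (b * a) :=
    Ideal.Quotient.eq.mpr (hMlie a b)
  have hunit {q : A ⧸ M} : IsUnit q ↔ q ≠ 0 := by
    obtain ⟨a, rfl⟩ := Ideal.Quotient.mk_surjective q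
    have : Nontrivial (A ⧸ M) := Ideal.Quotient.nontrivial_iff.mpr hM.ne_top
    refine ⟨fun h => h.ne_zero, fun h => ?_⟩
    rw [Ne, Ideal.Quotient.eq_zero_iff_mem] at h
    obtain ⟨b, m, hm, hbm⟩ := hM.exists_inv h
    have h1 : Ideal.Quotient.mk M (b * a) = 1 := by
      rw [← map_one (Ideal.Quotient.mk M), ← hbm, map_add, Ideal.Quotient.eq_zero_iff_mem.mpr hm,
        add_zero]
    exact isUnit_iff_exists.mpr ⟨Ideal.Quotient.mk M b, by rw [← map_mul, hcomm, h1],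
      by rw [← map_mul, h1]⟩
  exact ⟨((NormedRing.algEquivComplexOfComplete hunit).symm : (A ⧸ M) →ₐ[ℂ] ℂ).comp
    (Ideal.Quotient.mkₐ ℂ M)⟩

lemma isTracialState_of_algHom (φ : A →ₐ[ℂ] ℂ) : IsTracialState φ.toLinearMap where
  nonneg a := by
    rw [AlgHom.toLinearMap_apply, map_mul, map_star]
    exact star_mul_self_nonneg _
  map_one := map_one φ
  map_mul_comm a b := by
    rw [AlgHom.toLinearMap_apply, AlgHom.toLinearMap_apply, map_mul, map_mul, mul_comm]

lemma isCharacter_of_algHom (φ : A →ₐ[ℂ] ℂ) : IsCharacter φ.toLinearMap := by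
  refine ⟨⟨φ, map_star φ⟩, fun h => ?_, fun _ => rfl⟩
  have h1 : φ 1 = 0 := DFunLike.congr_fun h (1 : A)
  exact one_ne_zero ((map_one φ).symm.trans h1)

/-! ### From a topologically simple group to a simple algebra -/

lemma mem_of_forall_expUnitary_mem {W : Submodule ℂ A} (hW : IsClosed (W : Set A))
    {k : selfAdjoint A} (h : ∀ t : ℝ, (expUnitary (t • k) : A) ∈ W) : (k : A) ∈ W := by
  have hd := hasDerivAt_expUnitary_smul k
  rw [hasDerivAt_iff_tendsto_slope_zero] at hd
  have h1 : I • (k : A) ∈ W := by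
    refine hW.mem_of_tendsto hd (Eventually.of_forall fun s => ?_)
    rw [← Complex.coe_smul]
    exact W.smul_mem _ (W.sub_mem (h _) (h _))
  simpa [smul_smul] using W.smul_mem (-I) h1

/-- A two-sided ideal of a complex algebra as a subspace. -/
def TwoSidedIdeal.toComplexSubmodule (J : TwoSidedIdeal A) : Submodule ℂ A where
  carrier := J
  zero_mem' := J.zero_mem
  add_mem' := J.add_mem
  smul_mem' := by
    intro c x hx
    rw [Algebra.smul_def]
    exact J.mul_mem_left _ _ hx

lemma mem_toComplexSubmodule_sup_span_one {J : TwoSidedIdeal A} {x : A} :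
    x ∈ J.toComplexSubmodule ⊔ Submodule.span ℂ {1} ↔ ∃ z : ℂ, x - algebraMap ℂ A z ∈ J := by
  rw [Submodule.mem_sup]
  constructor
  · rintro ⟨y, hy, w, hw, rfl⟩
    obtain ⟨z, rfl⟩ := Submodule.mem_span_singleton.mp hw
    exact ⟨z, by rwa [← Algebra.algebraMap_eq_smul_one, add_sub_cancel_right]⟩
  · rintro ⟨z, hz⟩
    exact ⟨_, hz, algebraMap ℂ A z, Submodule.mem_span_singleton.mpr
      ⟨z, (Algebra.algebraMap_eq_smul_one z).symm⟩, sub_add_cancel _ _⟩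

/-- If all commutators are scalar modulo an ideal `J`, they lie in `J`: if `[x, y] ≡ z ≠ 0`
then `[x, y x] ≡ z x`, so `x` is scalar modulo `J`. -/
lemma lie_mem_of_lie_mem_sup_span_one {J : TwoSidedIdeal A}
    (h : ∀ x y : A, ∃ z : ℂ, ⁅x, y⁆ - algebraMap ℂ A z ∈ J) (x y : A) : ⁅x, y⁆ ∈ J := by
  obtain ⟨z, hz⟩ := h x y
  by_cases hz0 : z = 0
  · simpa [hz0] using hz
  obtain ⟨w, hw⟩ := h x (y * x)
  have hx : x - algebraMap ℂ A (z⁻¹ * w) ∈ J := by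
    have h1 : z • x - algebraMap ℂ A w ∈ J := by
      have e : z • x - algebraMap ℂ A w =
          (⁅x, y * x⁆ - algebraMap ℂ A w) - (⁅x, y⁆ - algebraMap ℂ A z) * x := by
        simp only [Ring.lie_def, Algebra.smul_def]
        noncomm_ring
      rw [e]
      exact J.sub_mem hw (J.mul_mem_right _ _ hz)
    have h2 := J.toComplexSubmodule.smul_mem z⁻¹ h1
    rw [smul_sub, smul_smul, inv_mul_cancel₀ hz0, one_smul, Algebra.smul_def z⁻¹, ← map_mul] at h2
    exact h2
  have e : ⁅x, y⁆ = (x - algebraMap ℂ A (z⁻¹ * w)) * y - y * (x - algebraMap ℂ A (z⁻¹ * w)) := by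
    rw [sub_mul, mul_sub, Algebra.commutes, Ring.lie_def]
    abel
  rw [e]
  exact J.sub_mem (J.mul_mem_right _ _ hx) (J.mul_mem_left _ _ hx)

lemma exp_sub_one_mem {J : TwoSidedIdeal A} (hJ : IsClosed (J : Set A)) {x : A} (hx : x ∈ J) :
    NormedSpace.exp x - 1 ∈ J := by
  have h := NormedSpace.exp_series_hasSum_exp' (𝕂 := ℂ) x
  have h1 := ((hasSum_nat_add_iff' 1).mpr h).tendsto_sum_nat
  simp only [Finset.range_one, Finset.sum_singleton, Nat.factorial_zero, Nat.cast_one, inv_one,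
    pow_zero, one_smul] at h1
  refine hJ.mem_of_tendsto h1 (Eventually.of_forall fun n => ?_)
  refine J.toComplexSubmodule.sum_mem fun i _ => Submodule.smul_mem _ _ ?_
  rw [pow_succ]
  exact J.mul_mem_left _ _ hx

/-- If every commutator `[h, b]` with `h` self-adjoint in the nonzero ideal `J` vanishes, then some
proper ideal contains all commutators: the annihilator of a nonzero central `e ∈ J`. -/
lemma exists_ideal_of_lie_eq_zero {J : TwoSidedIdeal A} (hJ : J ≠ ⊥)
    (h : ∀ a b : selfAdjoint A, (a : A) ∈ J → ⁅(a : A), (b : A)⁆ = 0) :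
    ∃ K : Ideal A, K ≠ ⊤ ∧ ∀ a b : A, ⁅a, b⁆ ∈ K := by
  obtain ⟨x, hx, hx0⟩ : ∃ x ∈ J, x ≠ 0 := by
    by_contra! hcon
    exact hJ (eq_bot_iff.mpr fun x hx => (TwoSidedIdeal.mem_bot A).mpr (hcon x hx))
  set e : A := x * star x with he
  have hesa : IsSelfAdjoint e := IsSelfAdjoint.mul_star_self x
  have heJ : e ∈ J := J.mul_mem_right _ _ hx
  have he0 : e ≠ 0 := fun h0 => hx0 (CStarRing.mul_star_self_eq_zero_iff x |>.mp h0)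
  have hcent (a : A) (ha : IsSelfAdjoint a) (haJ : a ∈ J) (b : A) : ⁅a, b⁆ = 0 :=
    lie_eq_zero_of_forall_isSelfAdjoint (fun b hb => h ⟨a, ha⟩ ⟨b, hb⟩ haJ) b
  have hec (b : A) : e * b = b * e := sub_eq_zero.mp (hcent e hesa heJ b)
  have hann (c : A) (hc : IsSelfAdjoint c) (b : A) : e * ⁅c, b⁆ = 0 := by
    have h1 : IsSelfAdjoint (e * c) := by
      rw [IsSelfAdjoint, star_mul, hesa.star_eq, hc.star_eq, hec]
    have h2 := hcent (e * c) h1 (J.mul_mem_right _ _ heJ) b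
    rw [← h2, Ring.lie_def, Ring.lie_def, mul_sub, ← mul_assoc b, ← hec b]
    simp only [mul_assoc]
  refine ⟨{ carrier := {y | e * y = 0}
            zero_mem' := mul_zero e
            add_mem' := by
              intro y z (hy : _ = _) (hz : _ = _)
              change e * (y + z) = 0
              rw [mul_add, hy, hz, add_zero]
            smul_mem' := by
              intro c y (hy : _ = _)
              change e * (c * y) = 0
              rw [← mul_assoc, hec, mul_assoc, hy, mul_zero] }, fun htop => ?_, fun a b => ?_⟩
  · rw [Ideal.eq_top_iff_one] at htop
    exact he0 (by simpa using (show e * 1 = 0 from htop))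
  · change e * ⁅a, b⁆ = 0
    rw [← realPart_add_I_smul_imaginaryPart a, add_lie, smul_lie, mul_add, mul_smul_comm,
      hann _ (realPart a).2, hann _ (imaginaryPart a).2, smul_zero, add_zero]

/-- The subgroup of those elements of `CU_A` that are scalar modulo the proper ideal `J`. The scalar
is not required to have modulus one. -/
def scalarModSubgroup (J : TwoSidedIdeal A) (hJ : (1 : A) ∉ J) :
    Subgroup (closedCommutatorUnitary A) where
  carrier := {u | ∃ z : ℂ, ((u : unitary A) : A) - algebraMap ℂ A z ∈ J}
  one_mem' := ⟨1, by simp⟩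
  mul_mem' := by
    rintro u v ⟨z, hz⟩ ⟨w, hw⟩
    refine ⟨z * w, ?_⟩
    have e : (((u * v : closedCommutatorUnitary A) : unitary A) : A) - algebraMap ℂ A (z * w) =
        (((u : unitary A) : A) - algebraMap ℂ A z) * ((v : unitary A) : A) +
          algebraMap ℂ A z * (((v : unitary A) : A) - algebraMap ℂ A w) := by
      rw [map_mul, Subgroup.coe_mul, Submonoid.coe_mul]
      noncomm_ring
    rw [e]
    exact J.add_mem (J.mul_mem_right _ _ hz) (J.mul_mem_left _ _ hw)
  inv_mem' := by
    rintro u ⟨z, hz⟩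
    have hu : (((u⁻¹ : closedCommutatorUnitary A) : unitary A) : A) * ((u : unitary A) : A) = 1 := by
      rw [← Submonoid.coe_mul, ← Subgroup.coe_mul, inv_mul_cancel]
      rfl
    have hz0 : z ≠ 0 := by
      rintro rfl
      rw [map_zero, sub_zero] at hz
      exact hJ (hu ▸ J.mul_mem_left _ _ hz)
    refine ⟨z⁻¹, ?_⟩
    have h1 := J.toComplexSubmodule.smul_mem (-z⁻¹)
      (J.mul_mem_left (((u⁻¹ : closedCommutatorUnitary A) : unitary A) : A) _ hz)
    rw [mul_sub, hu, ← Algebra.commutes, ← Algebra.smul_def, smul_sub, smul_smul, neg_mul,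
      inv_mul_cancel₀ hz0, neg_smul, neg_smul, one_smul, ← Algebra.algebraMap_eq_smul_one] at h1
    rwa [sub_neg_eq_add, neg_add_eq_sub] at h1

lemma isClosed_toComplexSubmodule_sup_span_one {J : TwoSidedIdeal A} (hJ : IsClosed (J : Set A)) :
    IsClosed ((J.toComplexSubmodule ⊔ Submodule.span ℂ {1} : Submodule ℂ A) : Set A) :=
  Submodule.isClosed_sup_finiteDimensional _ _ hJ

lemma isClosed_scalarModSubgroup {J : TwoSidedIdeal A} (hJ : IsClosed (J : Set A))
    (h1 : (1 : A) ∉ J) : IsClosed (scalarModSubgroup J h1 : Set (closedCommutatorUnitary A)) := by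
  have e : (scalarModSubgroup J h1 : Set (closedCommutatorUnitary A)) =
      (fun u : closedCommutatorUnitary A => ((u : unitary A) : A)) ⁻¹'
        ((J.toComplexSubmodule ⊔ Submodule.span ℂ {1} : Submodule ℂ A) : Set A) := by
    ext u
    exact mem_toComplexSubmodule_sup_span_one.symm
  rw [e]
  exact (isClosed_toComplexSubmodule_sup_span_one hJ).preimage (by fun_prop)

instance normal_scalarModSubgroup (J : TwoSidedIdeal A) (h1 : (1 : A) ∉ J) :
    (scalarModSubgroup J h1).Normal where
  conj_mem := by
    rintro u ⟨z, hz⟩ c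
    refine ⟨z, ?_⟩
    have hc : ((c : unitary A) : A) * (((c⁻¹ : closedCommutatorUnitary A) : unitary A) : A) = 1 := by
      rw [← Submonoid.coe_mul, ← Subgroup.coe_mul, mul_inv_cancel]
      rfl
    have := J.mul_mem_right _ (((c⁻¹ : closedCommutatorUnitary A) : unitary A) : A)
      (J.mul_mem_left ((c : unitary A) : A) _ hz)
    rwa [mul_sub, sub_mul, ← Algebra.commutes, mul_assoc (algebraMap ℂ A z), hc, mul_one] at this

/-- If `CU_A` modulo its center is topologically simple and the center consists of scalars, then a
nontrivial closed ideal of `A` gives rise to a proper ideal containing all commutators. -/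
lemma exists_ideal_of_isTopologicallySimple
    (hts : IsTopologicallySimple
      (closedCommutatorUnitary A ⧸ Subgroup.center (closedCommutatorUnitary A)))
    (hcenter : ∀ u ∈ Subgroup.center (closedCommutatorUnitary A),
      ∃ z : ℂ, ((u : unitary A) : A) = algebraMap ℂ A z)
    {J : TwoSidedIdeal A} (hJ : IsClosed (J : Set A)) (hbot : J ≠ ⊥) (h1 : (1 : A) ∉ J) :
    ∃ K : Ideal A, K ≠ ⊤ ∧ ∀ a b : A, ⁅a, b⁆ ∈ K := by
  set Z := Subgroup.center (closedCommutatorUnitary A)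
  set N := scalarModSubgroup J h1
  have hZN : Z ≤ N := fun u hu => by
    obtain ⟨z, hz⟩ := hcenter u hu
    exact ⟨z, by rw [hz, sub_self]; exact J.zero_mem⟩
  have hcomap : (N.map (QuotientGroup.mk' Z)).comap (QuotientGroup.mk' Z) = N := by
    rw [QuotientGroup.comap_map_mk', sup_eq_right.mpr hZN]
  have hclosed : IsClosed ((N.map (QuotientGroup.mk' Z) : Subgroup _) :
      Set (closedCommutatorUnitary A ⧸ Z)) := by
    rw [← (QuotientGroup.isQuotientMap_mk (N := Z)).isClosed_preimage]
    have hN : IsClosed (N : Set (closedCommutatorUnitary A)) := isClosed_scalarModSubgroup hJ h1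
    rw [← hcomap] at hN
    exact hN
  rcases hts _ ((normal_scalarModSubgroup J h1).map _ (QuotientGroup.mk'_surjective Z)) hclosed
    with h | h
  · have hNZ : N ≤ Z := by
      rw [Subgroup.map_eq_bot_iff, QuotientGroup.ker_mk'] at h
      exact h
    refine exists_ideal_of_lie_eq_zero hbot fun a b ha => ?_
    have habJ : (lieI a b : A) ∈ J := J.toComplexSubmodule.smul_mem _
      (J.sub_mem (J.mul_mem_right _ _ ha) (J.mul_mem_left _ _ ha))
    -- Here `exp (i t k)`, with `k = i [a, b] ∈ J`, is an element of `CU_A` in `1 + J`, so it is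
    -- a scalar.
    have hspan : (lieI a b : A) ∈ Submodule.span ℂ {(1 : A)} := by
      refine mem_of_forall_expUnitary_mem (Submodule.closed_of_finiteDimensional _) fun t => ?_
      obtain ⟨z, hz⟩ := hcenter ⟨_, lieI_mem_tangentSpace_closedCommutatorUnitary a b t⟩ (hNZ ⟨1, by
        rw [map_one]
        refine exp_sub_one_mem hJ (J.toComplexSubmodule.smul_mem _ ?_)
        rw [selfAdjoint.val_smul, ← Complex.coe_smul]
        exact J.toComplexSubmodule.smul_mem _ habJ⟩)
      rw [Submodule.mem_span_singleton]
      exact ⟨z, by rw [← Algebra.algebraMap_eq_smul_one, ← hz]⟩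
    obtain ⟨z, hz⟩ := Submodule.mem_span_singleton.mp hspan
    have hz0 : z = 0 := by
      by_contra hne
      rw [← hz] at habJ
      have := J.toComplexSubmodule.smul_mem z⁻¹ habJ
      rw [smul_smul, inv_mul_cancel₀ hne, one_smul] at this
      exact h1 this
    rw [hz0, zero_smul] at hz
    exact (smul_eq_zero.mp hz.symm).resolve_left I_ne_zero
  · have hN : N = ⊤ := by rw [← hcomap, h, Subgroup.comap_top]
    refine ⟨TwoSidedIdeal.asIdeal J, fun h => h1 ?_, ?_⟩
    · rw [Ideal.eq_top_iff_one] at h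
      exact TwoSidedIdeal.mem_asIdeal.mp h
    intro x y
    refine TwoSidedIdeal.mem_asIdeal.mpr (lie_mem_of_lie_mem_sup_span_one (fun x y => ?_) x y)
    rw [← mem_toComplexSubmodule_sup_span_one]
    have hmem (k : selfAdjoint A)
        (hk : k ∈ tangentSpace (closedCommutatorUnitary A) isClosed_closedCommutatorUnitary) :
        (k : A) ∈ J.toComplexSubmodule ⊔ Submodule.span ℂ {1} := by
      refine mem_of_forall_expUnitary_mem (isClosed_toComplexSubmodule_sup_span_one hJ) fun t => ?_
      rw [mem_toComplexSubmodule_sup_span_one]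
      have hu : (⟨_, hk t⟩ : closedCommutatorUnitary A) ∈ N := by rw [hN]; exact Subgroup.mem_top _
      exact hu
    obtain ⟨hr, hi⟩ := lie_mem_complexification_of_forall
      lieI_mem_tangentSpace_closedCommutatorUnitary x y
    rw [← realPart_add_I_smul_imaginaryPart ⁅x, y⁆]
    exact Submodule.add_mem _ (hmem _ hr) (Submodule.smul_mem _ _ (hmem _ hi))

end Simple

theorem mainTheorem9 (A : Type*) [CStarAlgebra A] [Nontrivial A]
    (h_unique : ∀ τ σ : A →ₗ[ℂ] ℂ, IsTracialState τ → IsTracialState σ → τ = σ)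
    (h_not_char : ∀ τ : A →ₗ[ℂ] ℂ, IsTracialState τ → ¬ IsCharacter τ) :
    IsSimpleCStar A ↔
      IsTopologicallySimple
          (closedCommutatorUnitary A ⧸ Subgroup.center (closedCommutatorUnitary A)) ∧
        ∀ u ∈ Subgroup.center (closedCommutatorUnitary A),
          ∃ z : ℂ, ‖z‖ = 1 ∧ ((u : unitary A) : A) = algebraMap ℂ A z := by
  refine ⟨fun hA => ⟨hA.isTopologicallySimple, hA.exists_eq_algebraMap_of_mem_center⟩, ?_⟩
  rintro ⟨hts, hcenter⟩
  refine ⟨inferInstance, fun J hJ => ?_⟩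
  by_contra! hcon
  have h1 : (1 : A) ∉ J := fun h1 => hcon.2 (TwoSidedIdeal.one_mem_iff J |>.mp h1)
  obtain ⟨K, hK, hlie⟩ := exists_ideal_of_isTopologicallySimple hts
    (fun u hu => (hcenter u hu).imp fun _ h => h.2) hJ hcon.1 h1
  obtain ⟨φ⟩ := exists_algHom_complex K hK hlie
  exact h_not_char _ (isTracialState_of_algHom φ) (isCharacter_of_algHom φ)
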